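/- Let $\mathcal{ML}_2$ be the set of bimodal formulas $\psi ::= p \mid \bot \mid \psi\to\psi \mid \square\psi \mid [\ne]\psi$ over a countably infinite set of propositional variables, with the other Boolean connectives defined as usual, $\langle\ne\rangle A = \neg[\ne]\neg A$ and $[\forall]A = [\ne]A\wedge A$. A normal bimodal logic is a set of formulas that contains all classical tautologies, contains $\square(p\to q)\to(\square p\to\square q)$ and $[\ne](p\to q)\to([\ne]p\to[\ne]q)$, and is closed under modus ponens, the necessitation rules $A/\square A$ and $A/[\ne]A$, and substitution of formulas for variables. Let $\mathbf{S4DT_0}$ be the least normal bimodal logic containing $$\square p\to p,\qquad \square p\to\square\square p,\qquad [\forall]p\to\square p,\qquad p\to[\ne]\langle\ne\rangle p,\qquad [\forall]p\to[\ne][\ne]p,$$ $$(p\wedge[\ne]\neg p\wedge\langle\ne\rangle(q\wedge[\ne]\neg q))\to(\square\neg q\vee\langle\ne\rangle(q\wedge\square\neg p)).$$ A Kripke frame is a triple $(W,R,R_D)$ with $W$ a nonempty set and $R,R_D$ binary relations on $W$; $\square$ is interpreted by $R$ and $[\ne]$ by $R_D$, a formula is valid in a frame if it is true at every point under every valuation,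 and the logic of a class of frames is the set of formulas valid in all frames of the class. Then $\mathbf{S4DT_0}$ has the finite model property (is finitely approximable): there is a class $Q$ of finite Kripke frames $(W,R,R_D)$ whose logic is exactly $\mathbf{S4DT_0}$. -/

import Mathlib

namespace DiffLogic

/-- Bimodal formulas over the countable set of propositional variables `var 0, var 1, …`.
`box` is `□` and `dbox` is the difference modality `[≠]`. -/
inductive Formula : Type where
  | var : ℕ → Formula
  | bot : Formula
  | imp : Formula → Formula → Formula
  | box : Formula → Formula
  | dbox : Formula → Formula

namespace Formula

def neg (A : Formula) : Formula := imp A bot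

def or (A B : Formula) : Formula := imp (neg A) B

def and (A B : Formula) : Formula := neg (imp A (neg B))

/-- `⟨≠⟩ A = ¬ [≠] ¬ A`. -/
def ddia (A : Formula) : Formula := neg (dbox (neg A))

/-- `[∀] A = [≠] A ∧ A`. -/
def univ (A : Formula) : Formula := and (dbox A) A

/-- `subst B p A` is `[B/p] A`: every occurrence of the variable `p` in `A` is replaced by `B`. -/
def subst (B : Formula) (p : ℕ) : Formula → Formula
  | var n => if n = p then B else var n
  | bot => bot
  | imp A C => imp (subst B p A) (subst B p C)
  | box A => box (subst B p A)
  | dbox A => dbox (subst B p A)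

/-- Classical tautologies in the bimodal language: true under every truth assignment respecting
`⊥` and `→`, where variables and formulas beginning with a modal operator get arbitrary values. -/
def IsTautology (A : Formula) : Prop :=
  ∀ v : Formula → Prop, ¬ v bot → (∀ B C, v (imp B C) ↔ (v B → v C)) → v A

end Formula

open Formula

/-- The propositional variable `p`. -/
def p : Formula := var 0

/-- The propositional variable `q`. -/
def q : Formula := var 1

/-- Normal bimodal logics. -/
structure IsNormalLogic (L : Set Formula) : Prop where
  taut : ∀ A, IsTautology A → A ∈ L
  k_box : imp (box (imp p q)) (imp (box p) (box q)) ∈ L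
  k_dbox : imp (dbox (imp p q)) (imp (dbox p) (dbox q)) ∈ L
  mp : ∀ A B, imp A B ∈ L → A ∈ L → B ∈ L
  nec_box : ∀ A, A ∈ L → box A ∈ L
  nec_dbox : ∀ A, A ∈ L → dbox A ∈ L
  sub : ∀ (A B : Formula) (n : ℕ), A ∈ L → subst B n A ∈ L

/-- `L + Γ`: the least normal bimodal logic containing `L ∪ Γ`. -/
def addAxioms (L Γ : Set Formula) : Set Formula :=
  ⋂₀ {L' | IsNormalLogic L' ∧ L ∪ Γ ⊆ L'}

/-- `K₂`: the least normal bimodal logic. -/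
def K2 : Set Formula := ⋂₀ {L | IsNormalLogic L}

/-- `□p → p` -/
def axT : Formula := imp (box p) p

/-- `□p → □□p` -/
def ax4 : Formula := imp (box p) (box (box p))

/-- `[∀]p → □p` -/
def axD : Formula := imp (univ p) (box p)

/-- `p → [≠]⟨≠⟩p` -/
def axBD : Formula := imp p (dbox (ddia p))

/-- `[∀]p → [≠][≠]p` -/
def ax4D : Formula := imp (univ p) (dbox (dbox p))

/-- `(p ∧ [≠]¬p ∧ ⟨≠⟩(q ∧ [≠]¬q)) → (□¬q ∨ ⟨≠⟩(q ∧ □¬p))` -/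
def axAT0 : Formula :=
  imp (and (and p (dbox (neg p))) (ddia (and q (dbox (neg q)))))
    (or (box (neg q)) (ddia (and q (box (neg p)))))

/-- `S4D = K₂ + T + 4 + D + B_D + 4_D`. -/
def S4D : Set Formula := addAxioms K2 {axT, ax4, axD, axBD, ax4D}

/-- `S4DT₀ = S4D + AT₀`. -/
def S4DT0 : Set Formula := addAxioms S4D {axAT0}

/-- Kripke frames `(W, R, R_D)` with `W` nonempty. -/
structure KripkeFrame : Type 1 where
  W : Type
  nonempty : Nonempty W
  R : W → W → Prop
  RD : W → W → Prop

/-- Truth of a formula at a point of the Kripke model `(F, V)`. -/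
def Truth (F : KripkeFrame) (V : ℕ → Set F.W) : F.W → Formula → Prop
  | x, var n => x ∈ V n
  | _, bot => False
  | x, imp A B => Truth F V x A → Truth F V x B
  | x, box A => ∀ y, F.R x y → Truth F V y A
  | x, dbox A => ∀ y, F.RD x y → Truth F V y A

/-- Validity of a formula in a frame: truth at every point under every valuation. -/
def KripkeFrame.Valid (F : KripkeFrame) (A : Formula) : Prop :=
  ∀ (V : ℕ → Set F.W) (x : F.W), Truth F V x A

/-- The logic `L(C)` of a class `C` of frames. -/
def logicOf (C : Set KripkeFrame) : Set Formula := {A | ∀ F ∈ C, F.Valid A}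

end DiffLogic

namespace DiffLogic

open Formula

/-! ### Normal logics and simultaneous substitution -/

section Logic

variable {L : Set Formula}

/-! The class `Q` consists of the finite frames satisfying `IsT0Frame`; soundness is
`IsT0Frame.valid`. For completeness, a non-theorem fails at some maximal consistent set, and the
part of the canonical frame generated by it is again an `IsT0Frame`: an `R_D`-irreflexive point is
named by a formula true only there, so AT₀ applies to two such points.

Plain filtration of this model could merge `□`-clusters and break the T₀ condition. So a class also
records which isolated points (irreflexive, alone in their type) it sees; only these give
irreflexive classes. There are finitely many of them, hence finitely many classes, and mutual access
between irreflexive classes lifts to the original frame (`isT0Frame_filtration`,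
`truth_filtration`). -/

theorem IsNormalLogic.sInter {S : Set (Set Formula)} (h : ∀ L ∈ S, IsNormalLogic L) :
    IsNormalLogic (⋂₀ S) where
  taut A hA := fun L hL => (h L hL).taut A hA
  k_box := fun L hL => (h L hL).k_box
  k_dbox := fun L hL => (h L hL).k_dbox
  mp A B hAB hA := fun L hL => (h L hL).mp A B (hAB L hL) (hA L hL)
  nec_box A hA := fun L hL => (h L hL).nec_box A (hA L hL)
  nec_dbox A hA := fun L hL => (h L hL).nec_dbox A (hA L hL)
  sub A B n hA := fun L hL => (h L hL).sub A B n (hA L hL)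

theorem isNormalLogic_addAxioms (L Γ : Set Formula) : IsNormalLogic (addAxioms L Γ) :=
  IsNormalLogic.sInter fun _ h => h.1

theorem subset_addAxioms (L Γ : Set Formula) : L ∪ Γ ⊆ addAxioms L Γ :=
  fun _ hA _ hL => hL.2 hA

theorem isNormalLogic_S4DT0 : IsNormalLogic S4DT0 := isNormalLogic_addAxioms _ _

theorem S4D_axiom_mem_S4DT0 {A : Formula} (hA : A ∈ ({axT, ax4, axD, axBD, ax4D} : Set Formula)) :
    A ∈ S4DT0 :=
  subset_addAxioms _ _ (Or.inl (subset_addAxioms _ _ (Or.inr hA)))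

theorem axAT0_mem_S4DT0 : axAT0 ∈ S4DT0 := subset_addAxioms _ _ (Or.inr rfl)

theorem S4DT0_subset (hL : IsNormalLogic L)
    (h : ∀ A ∈ ({axT, ax4, axD, axBD, ax4D} : Set Formula), A ∈ L) (h0 : axAT0 ∈ L) :
    S4DT0 ⊆ L := by
  refine Set.sInter_subset_of_mem ⟨hL, Set.union_subset (Set.sInter_subset_of_mem
    ⟨hL, Set.union_subset (Set.sInter_subset_of_mem hL) h⟩) ?_⟩
  rintro _ rfl
  exact h0

/-- Every formula is unchanged by substitution for sufficiently large variables. -/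
theorem exists_fresh (A : Formula) : ∃ m, ∀ k ≥ m, ∀ B, subst B k A = A := by
  induction A with
  | var n =>
    refine ⟨n + 1, fun k hk B => ?_⟩
    have : n ≠ k := by omega
    simp [subst, this]
  | bot => exact ⟨0, fun _ _ _ => rfl⟩
  | imp A C hA hC =>
    obtain ⟨m, hm⟩ := hA
    obtain ⟨n, hn⟩ := hC
    refine ⟨max m n, fun k hk B => ?_⟩
    simp [subst, hm k (le_trans (le_max_left _ _) hk), hn k (le_trans (le_max_right _ _) hk)]
  | box A hA =>
    obtain ⟨m, hm⟩ := hA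
    exact ⟨m, fun k hk B => by simp [subst, hm k hk]⟩
  | dbox A hA =>
    obtain ⟨m, hm⟩ := hA
    exact ⟨m, fun k hk B => by simp [subst, hm k hk]⟩

/-- Substitutions act one variable at a time, so `q` is first renamed to a variable fresh for `A`;
otherwise substituting `B` could alter the copies of `A`. -/
theorem IsNormalLogic.subst_two (hL : IsNormalLogic L) {C : Formula} (hC : C ∈ L)
    (A B : Formula) :
    ∃ m, m ≠ 0 ∧ m ≠ 1 ∧ subst B m A = A ∧
      subst B m (subst A 0 (subst (var m) 1 C)) ∈ L := by
  obtain ⟨m, hm⟩ := exists_fresh A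
  exact ⟨m + 2, by omega, by omega, hm _ (by omega) _,
    hL.sub _ _ _ (hL.sub _ _ _ (hL.sub _ _ _ hC))⟩

theorem IsNormalLogic.box_K (hL : IsNormalLogic L) (A B : Formula) :
    imp (box (imp A B)) (imp (box A) (box B)) ∈ L := by
  obtain ⟨m, h0, h1, hA, h⟩ := hL.subst_two hL.k_box A B
  simpa [subst, p, q, h0, h1, hA] using h

theorem IsNormalLogic.dbox_K (hL : IsNormalLogic L) (A B : Formula) :
    imp (dbox (imp A B)) (imp (dbox A) (dbox B)) ∈ L := by
  obtain ⟨m, h0, h1, hA, h⟩ := hL.subst_two hL.k_dbox A B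
  simpa [subst, p, q, h0, h1, hA] using h

end Logic

/-! ### Maximal consistent sets and Lindenbaum's lemma -/

/-- Theories of `L`: sets of formulas containing `L` and closed under modus ponens. -/
structure IsTheory (L T : Set Formula) : Prop where
  sub : L ⊆ T
  mp : ∀ A B, imp A B ∈ T → A ∈ T → B ∈ T

/-- Maximal consistent sets of `L`. -/
structure World (L : Set Formula) where
  carrier : Set Formula
  sub : L ⊆ carrier
  bot_notMem : bot ∉ carrier
  mem_imp : ∀ A B, imp A B ∈ carrier ↔ (A ∈ carrier → B ∈ carrier)

section Lindenbaum

variable {L : Set Formula}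

theorem exists_maximal_theory {T : Set Formula} (hT : IsTheory L T) {A : Formula} (hA : A ∉ T) :
    ∃ M, T ⊆ M ∧ Maximal (· ∈ {T' | IsTheory L T' ∧ A ∉ T'}) M := by
  refine zorn_subset_nonempty {T' | IsTheory L T' ∧ A ∉ T'} ?_ T ⟨hT, hA⟩
  rintro c hc hchain ⟨T₀, hT₀⟩
  refine ⟨⋃₀ c, ⟨⟨fun B hB => ⟨T₀, hT₀, (hc hT₀).1.sub hB⟩, ?_⟩, ?_⟩,
    fun s hs => Set.subset_sUnion_of_mem hs⟩
  · rintro B C ⟨T₁, h₁, hBC⟩ ⟨T₂, h₂, hB⟩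
    rcases hchain.total h₁ h₂ with h | h
    · exact ⟨T₂, h₂, (hc h₂).1.mp B C (h hBC) hB⟩
    · exact ⟨T₁, h₁, (hc h₁).1.mp B C hBC (h hB)⟩
  · rintro ⟨T₁, h₁, h⟩
    exact (hc h₁).2 h

theorem exists_world (hL : IsNormalLogic L) {T : Set Formula} (hT : IsTheory L T) {A : Formula}
    (hA : A ∉ T) : ∃ x : World L, T ⊆ x.carrier ∧ A ∉ x.carrier := by
  obtain ⟨M, hTM, hM⟩ := exists_maximal_theory hT hA
  have hth : IsTheory L M := hM.prop.1
  have hAM : A ∉ M := hM.prop.2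
  have taut : ∀ B, IsTautology B → B ∈ M := fun B hB => hth.sub (hL.taut B hB)
  have key : ∀ B, B ∉ M → imp B A ∈ M := by
    intro B hB
    by_contra hBA
    -- Deduction theorem: this is the theory generated by `M` and `B`, so maximality forces `B ∈ M`.
    have hN : IsTheory L {C | imp B C ∈ M} ∧ A ∉ {C | imp B C ∈ M} := by
      refine ⟨⟨fun C hC => ?_, fun C D hCD hC => ?_⟩, hBA⟩
      · exact hth.mp C _ (taut _ fun v _ hi => by simp only [hi]; tauto) (hth.sub hC)
      · exact hth.mp _ _ (hth.mp (imp B (imp C D)) (imp (imp B C) (imp B D))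
          (taut _ fun v _ hi => by simp only [hi]; tauto) hCD) hC
    have hle : M ⊆ {C | imp B C ∈ M} := fun C hC =>
      hth.mp C _ (taut _ fun v _ hi => by simp only [hi]; tauto) hC
    exact hB (hM.le_of_ge hN hle (taut _ fun v _ hi => by simp only [hi]; tauto : imp B B ∈ M))
  refine ⟨⟨M, hth.sub, fun h => hAM ?_, fun B C => ⟨hth.mp B C, fun h => ?_⟩⟩, hTM, hAM⟩
  · exact hth.mp bot A (taut _ fun v h0 hi => by simp only [hi]; tauto) h
  · by_contra hBC
    by_cases hB : B ∈ M
    · exact hBC (hth.mp C _ (taut _ fun v _ hi => by simp only [hi]; tauto) (h hB))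
    · exact hAM (hth.mp _ _ (hth.mp (imp (imp B C) A) (imp (imp B A) A)
        (taut _ fun v _ hi => by simp only [hi]; tauto) (key _ hBC)) (key _ hB))

end Lindenbaum

namespace World

variable {L : Set Formula}

instance : Membership Formula (World L) := ⟨fun x A => A ∈ x.carrier⟩

variable (x y z : World L) (A B : Formula)

theorem mem_of_logic {A : Formula} (h : A ∈ L) : A ∈ x := x.sub h

@[simp] theorem bot_mem : bot ∈ x ↔ False := iff_false_intro x.bot_notMem

@[simp] theorem imp_mem : imp A B ∈ x ↔ (A ∈ x → B ∈ x) := x.mem_imp A B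

@[simp] theorem neg_mem : neg A ∈ x ↔ A ∉ x := by simp [neg]

@[simp] theorem or_mem : Formula.or A B ∈ x ↔ A ∈ x ∨ B ∈ x := by
  simp [Formula.or]; tauto

@[simp] theorem and_mem : Formula.and A B ∈ x ↔ A ∈ x ∧ B ∈ x := by
  simp [Formula.and]

@[simp] theorem ddia_mem : ddia A ∈ x ↔ dbox (neg A) ∉ x := by simp [ddia]

variable {x y z}

theorem ext_of_subset (h : ∀ A, A ∈ x → A ∈ y) : x = y := by
  have : x.carrier = y.carrier := by
    refine Set.Subset.antisymm h fun A hA => ?_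
    by_contra hx
    have : neg A ∈ y := h _ ((neg_mem x A).2 hx)
    exact (neg_mem y A).1 this hA
  cases x; cases y; cases this; rfl

/-- Accessibility for `□` in the canonical frame. -/
def Acc (x y : World L) : Prop := ∀ A, box A ∈ x → A ∈ y

/-- Accessibility for `[≠]` in the canonical frame. -/
def DAcc (x y : World L) : Prop := ∀ A, dbox A ∈ x → A ∈ y

variable {A B}

theorem exists_acc (hL : IsNormalLogic L) (h : box A ∉ x) : ∃ y, Acc x y ∧ A ∉ y := by
  have hT : IsTheory L {B | box B ∈ x} :=
    ⟨fun B hB => x.mem_of_logic (hL.nec_box B hB), fun B C hBC hB =>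
      (imp_mem ..).1 ((imp_mem ..).1 (x.mem_of_logic (hL.box_K B C)) hBC) hB⟩
  obtain ⟨y, hy, hA⟩ := exists_world hL hT h
  exact ⟨y, fun B hB => hy hB, hA⟩

theorem exists_dacc (hL : IsNormalLogic L) (h : dbox A ∉ x) : ∃ y, DAcc x y ∧ A ∉ y := by
  have hT : IsTheory L {B | dbox B ∈ x} :=
    ⟨fun B hB => x.mem_of_logic (hL.nec_dbox B hB), fun B C hBC hB =>
      (imp_mem ..).1 ((imp_mem ..).1 (x.mem_of_logic (hL.dbox_K B C)) hBC) hB⟩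
  obtain ⟨y, hy, hA⟩ := exists_world hL hT h
  exact ⟨y, fun B hB => hy hB, hA⟩

theorem dbox_mono (hL : IsNormalLogic L) (hAB : ∀ y : World L, A ∈ y → B ∈ y)
    (h : dbox A ∈ x) : dbox B ∈ x := by
  by_contra hB
  obtain ⟨y, hy, hBy⟩ := exists_dacc hL hB
  exact hBy (hAB y (hy A h))

theorem box_iff (hL : IsNormalLogic L) : box A ∈ x ↔ ∀ y, Acc x y → A ∈ y := by
  refine ⟨fun h y hy => hy A h, fun h => ?_⟩
  by_contra hA
  obtain ⟨y, hy, hAy⟩ := exists_acc hL hA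
  exact hAy (h y hy)

theorem dbox_iff (hL : IsNormalLogic L) : dbox A ∈ x ↔ ∀ y, DAcc x y → A ∈ y := by
  refine ⟨fun h y hy => hy A h, fun h => ?_⟩
  by_contra hA
  obtain ⟨y, hy, hAy⟩ := exists_dacc hL hA
  exact hAy (h y hy)

end World

/-! ### What the axioms say about the canonical relations -/

namespace World

variable {x y z : World S4DT0}

theorem acc_refl (x : World S4DT0) : Acc x x := by
  intro A hA
  have h := isNormalLogic_S4DT0.sub _ A 0 (S4D_axiom_mem_S4DT0 (A := axT) (by simp))
  have h := x.mem_of_logic h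
  simp only [axT, p, subst, if_true, imp_mem] at h
  exact h hA

theorem acc_trans (hxy : Acc x y) (hyz : Acc y z) : Acc x z := by
  intro A hA
  have h := isNormalLogic_S4DT0.sub _ A 0 (S4D_axiom_mem_S4DT0 (A := ax4) (by simp))
  have h := x.mem_of_logic h
  simp only [ax4, p, subst, if_true, imp_mem] at h
  exact hyz A (hxy _ (h hA))

theorem dacc_symm (hxy : DAcc x y) : DAcc y x := by
  intro A hA
  have h := isNormalLogic_S4DT0.sub _ (neg A) 0 (S4D_axiom_mem_S4DT0 (A := axBD) (by simp))
  have h := x.mem_of_logic h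
  simp only [axBD, p, ddia, neg, subst, if_true, imp_mem, bot_mem] at h
  by_contra hAx
  have h' := hxy _ (h hAx)
  simp only [imp_mem, bot_mem] at h'
  exact h' (dbox_mono isNormalLogic_S4DT0 (fun y hy => by simpa using hy) hA)

/-- The axiom gives only `[∀]p → [≠][≠]p`. A formula `C` separating `x` from `z` makes `B ∨ C` hold
at `x` as well as at its `DAcc`-successors, yet fail at `z`. -/
theorem dacc_trans (hxy : DAcc x y) (hyz : DAcc y z) (hne : x ≠ z) : DAcc x z := by
  intro B hB
  by_contra hBz
  obtain ⟨C, hCx, hCz⟩ : ∃ C, C ∈ x ∧ C ∉ z := by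
    by_contra! hcon
    exact hne (ext_of_subset hcon)
  have h := isNormalLogic_S4DT0.sub _ (Formula.or B C) 0
    (S4D_axiom_mem_S4DT0 (A := ax4D) (by simp))
  have h := x.mem_of_logic h
  simp only [ax4D, p, Formula.univ, Formula.and, neg, subst, if_true, imp_mem, bot_mem] at h
  have hd : dbox (Formula.or B C) ∈ x :=
    dbox_mono isNormalLogic_S4DT0 (fun y hy => by simp [hy]) hB
  have h' := hyz _ (hxy _ (h fun h' => h' hd (by simp [hCx])))
  simp only [or_mem] at h'
  tauto

theorem dacc_of_acc (hxy : Acc x y) (hne : x ≠ y) : DAcc x y := by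
  intro B hB
  by_contra hBz
  obtain ⟨C, hCx, hCz⟩ : ∃ C, C ∈ x ∧ C ∉ y := by
    by_contra! hcon
    exact hne (ext_of_subset hcon)
  have h := isNormalLogic_S4DT0.sub _ (Formula.or B C) 0
    (S4D_axiom_mem_S4DT0 (A := axD) (by simp))
  have h := x.mem_of_logic h
  simp only [axD, p, Formula.univ, Formula.and, neg, subst, if_true, imp_mem, bot_mem] at h
  have hd : dbox (Formula.or B C) ∈ x :=
    dbox_mono isNormalLogic_S4DT0 (fun y hy => by simp [hy]) hB
  have h' := hxy _ (h fun h' => h' hd (by simp [hCx]))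
  simp only [or_mem] at h'
  tauto

theorem AT0_mem (A B : Formula) :
    imp (Formula.and (Formula.and A (dbox (neg A))) (ddia (Formula.and B (dbox (neg B)))))
      (Formula.or (box (neg B)) (ddia (Formula.and B (box (neg A))))) ∈ S4DT0 := by
  obtain ⟨m, h0, h1, hA, h⟩ := isNormalLogic_S4DT0.subst_two axAT0_mem_S4DT0 A B
  simpa [axAT0, ddia, Formula.and, Formula.or, neg, subst, p, q, h0, h1, hA] using h

theorem eq_of_acc_of_not_dacc_self (hD : x ≠ y → DAcc x y) (hx : ¬ DAcc x x) (hy : ¬ DAcc y y)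
    (hxy : Acc x y) (hyx : Acc y x) : x = y := by
  by_contra hne
  have hD := hD hne
  simp only [DAcc, not_forall] at hx hy
  obtain ⟨A, hAx, hA⟩ := hx
  obtain ⟨B, hBy, hB⟩ := hy
  -- `neg A` and `neg B` name `x` and `y`, so instances of AT₀ carry double negations.
  have hdn : ∀ (C : Formula) (z : World S4DT0), dbox C ∈ z → dbox (neg (neg C)) ∈ z := fun C z h =>
    dbox_mono isNormalLogic_S4DT0 (fun y hy => by simpa using hy) h
  have hdd : ddia (Formula.and (neg B) (dbox (neg (neg B)))) ∈ x := by
    rw [ddia_mem]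
    intro h
    have h := hD _ h
    rw [neg_mem, and_mem, neg_mem] at h
    exact h ⟨hB, hdn _ _ hBy⟩
  have h := x.mem_of_logic (AT0_mem (neg A) (neg B))
  rw [imp_mem, and_mem, and_mem, or_mem] at h
  rcases h ⟨⟨by simpa using hA, hdn _ _ hAx⟩, hdd⟩ with h | h
  · exact hB (by simpa using hxy _ h)
  · rw [ddia_mem] at h
    obtain ⟨z, hxz, hz⟩ := exists_dacc isNormalLogic_S4DT0 h
    -- The name of `y` holds at `z`, which forces `z = y`; then `□` of the negated name of `x`
    -- contradicts `Acc y x`.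
    rw [neg_mem, not_not, and_mem, neg_mem] at hz
    have hzy : y = z := by
      by_contra hyz
      exact hz.1 (dacc_trans (dacc_symm hD) hxz hyz B hBy)
    subst hzy
    exact hA (by simpa using hyx _ hz.2)

end World

/-- Frames in which `R` is a preorder, `R_D` contains `≠`, and no two distinct `R_D`-irreflexive
points see each other. -/
structure IsT0Frame (F : KripkeFrame) : Prop where
  refl : ∀ x, F.R x x
  trans : ∀ x y z, F.R x y → F.R y z → F.R x z
  dacc_of_ne : ∀ x y, x ≠ y → F.RD x y
  t0 : ∀ x y, ¬ F.RD x x → ¬ F.RD y y → F.R x y → F.R y x → x = y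

/-! ### Soundness for T₀ frames -/

section Soundness

variable (F : KripkeFrame)

theorem truth_subst (V : ℕ → Set F.W) (B : Formula) (n : ℕ) (A : Formula) (x : F.W) :
    Truth F V x (subst B n A) ↔ Truth F (Function.update V n {y | Truth F V y B}) x A := by
  induction A generalizing x with
  | var m =>
    by_cases h : m = n
    · subst h; simp [subst, Truth]
    · simp [subst, Truth, h]
  | bot => rfl
  | imp A C hA hC => simp [subst, Truth, hA, hC]
  | box A hA => simp [subst, Truth, hA]
  | dbox A hA => simp [subst, Truth, hA]

theorem isNormalLogic_valid : IsNormalLogic {A | F.Valid A} where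
  taut _ hA V x := hA (Truth F V x) id fun _ _ => Iff.rfl
  k_box _ _ := fun h h' y hy => h y hy (h' y hy)
  k_dbox _ _ := fun h h' y hy => h y hy (h' y hy)
  mp _ _ hAB hA V x := hAB V x (hA V x)
  nec_box _ hA V _ := fun y _ => hA V y
  nec_dbox _ hA V _ := fun y _ => hA V y
  sub A B n hA V x := (truth_subst F V B n A x).2 (hA _ x)

variable {F}

section Connectives

variable {V : ℕ → Set F.W} {x : F.W} {A B : Formula}

theorem truth_imp : Truth F V x (imp A B) ↔ (Truth F V x A → Truth F V x B) := Iff.rfl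

theorem truth_neg : Truth F V x (neg A) ↔ ¬ Truth F V x A := Iff.rfl

theorem truth_and : Truth F V x (Formula.and A B) ↔ Truth F V x A ∧ Truth F V x B := by
  simp [Formula.and, truth_neg, truth_imp]

theorem truth_or : Truth F V x (Formula.or A B) ↔ Truth F V x A ∨ Truth F V x B := by
  simp only [Formula.or, truth_neg, truth_imp]
  tauto

theorem truth_ddia : Truth F V x (ddia A) ↔ ∃ y, F.RD x y ∧ Truth F V y A := by
  simp [ddia, truth_neg, Truth]

theorem truth_univ :
    Truth F V x (Formula.univ A) ↔ (∀ y, F.RD x y → Truth F V y A) ∧ Truth F V x A :=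
  truth_and

end Connectives

theorem IsT0Frame.truth_of_univ (hF : IsT0Frame F) {V : ℕ → Set F.W} {x : F.W} {A : Formula}
    (h : Truth F V x (Formula.univ A)) (y : F.W) : Truth F V y A := by
  rw [truth_univ] at h
  by_cases hxy : x = y
  · exact hxy ▸ h.2
  · exact h.1 y (hF.dacc_of_ne x y hxy)

theorem IsT0Frame.valid (hF : IsT0Frame F) : S4DT0 ⊆ {A | F.Valid A} := by
  refine S4DT0_subset (isNormalLogic_valid F) ?_ ?_
  · simp only [Set.mem_insert_iff, Set.mem_singleton_iff, Set.mem_ofPred_eq]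
    rintro A (rfl | rfl | rfl | rfl | rfl) V x
    · exact fun h => h x (hF.refl x)
    · exact fun h y hxy z hyz => h z (hF.trans x y z hxy hyz)
    · exact fun h y _ => hF.truth_of_univ h y
    · intro h y hxy h'
      by_cases hyx : y = x
      · subst hyx
        exact h' y hxy h
      · exact h' x (hF.dacc_of_ne y x hyx) h
    · exact fun h y _ z _ => hF.truth_of_univ h z
  · intro V x
    simp only [axAT0, truth_imp, truth_and, truth_or, truth_ddia, Truth, truth_neg]
    rintro ⟨⟨hx, hx'⟩, y, hxy, hy, hy'⟩
    -- `p` holds only at `x` and `q` only at `y`, both irreflexive. If `y` sees `x`, the T₀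
    -- condition forbids `x` to see `y`.
    by_cases hyx : F.R y x
    · refine Or.inl fun z hxz hz => ?_
      have hzy : z = y := by
        by_contra hne
        exact hy' z (hF.dacc_of_ne y z (Ne.symm hne)) hz
      subst hzy
      have := hF.t0 x z (fun h => hx' x h hx) (fun h => hy' z h hz) hxz hyx
      subst this
      exact hx' x hxy hx
    · refine Or.inr ⟨y, hxy, hy, fun z hyz hz => hyx ?_⟩
      have hzx : z = x := by
        by_contra hne
        exact hx' z (hF.dacc_of_ne x z (Ne.symm hne)) hz
      exact hzx ▸ hyz

end Soundness

/-! ### Filtration remembering isolated points -/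

section Filtration

/-- The set of subformulas of a formula. -/
def subformulas : Formula → Set Formula
  | var n => {var n}
  | bot => {bot}
  | imp A B => insert (imp A B) (subformulas A ∪ subformulas B)
  | box A => insert (box A) (subformulas A)
  | dbox A => insert (dbox A) (subformulas A)

theorem self_mem_subformulas (A : Formula) : A ∈ subformulas A := by
  cases A <;> simp [subformulas]

theorem finite_subformulas (A : Formula) : (subformulas A).Finite := by
  induction A with
  | var n => exact Set.finite_singleton _
  | bot => exact Set.finite_singleton _
  | imp A B hA hB => exact (hA.union hB).insert _
  | box A hA => exact hA.insert _
  | dbox A hA => exact hA.insert _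

theorem subformulas_trans {A B : Formula} (h : A ∈ subformulas B) :
    subformulas A ⊆ subformulas B := by
  induction B with
  | var n => cases h; rfl
  | bot => cases h; rfl
  | imp B C hB hC =>
    rcases h with rfl | h | h
    · rfl
    · exact (hB h).trans (Set.subset_union_left.trans (Set.subset_insert _ _))
    · exact (hC h).trans (Set.subset_union_right.trans (Set.subset_insert _ _))
  | box B hB =>
    rcases h with rfl | h
    · rfl
    · exact (hB h).trans (Set.subset_insert _ _)
  | dbox B hB =>
    rcases h with rfl | h
    · rfl
    · exact (hB h).trans (Set.subset_insert _ _)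

variable {F : KripkeFrame} (V : ℕ → Set F.W) (φ : Formula)

/-- The subformulas of `φ` true at `x`. -/
def typeOf (x : F.W) : Set Formula := {A ∈ subformulas φ | Truth F V x A}

/-- The `R_D`-irreflexive points that are alone in having their type. -/
def isolated : Set F.W := {x | ¬ F.RD x x ∧ ∀ y, typeOf V φ y = typeOf V φ x → y = x}

/-- The type of `x` together with the isolated points that `x` sees. -/
def label (x : F.W) : Set Formula × Set F.W := (typeOf V φ x, {s ∈ isolated V φ | F.R x s})

theorem finite_isolated : (isolated V φ).Finite := by
  refine Set.Finite.of_finite_image (f := typeOf V φ)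
    ((finite_subformulas φ).finite_subsets.subset ?_) ?_
  · rintro _ ⟨x, -, rfl⟩
    exact fun A hA => hA.1
  · intro x _ y hy hxy
    exact hy.2 x hxy

theorem finite_range_label : (Set.range (label V φ)).Finite := by
  refine ((finite_subformulas φ).finite_subsets.prod
    (finite_isolated V φ).finite_subsets).subset ?_
  rintro _ ⟨x, rfl⟩
  exact ⟨fun A hA => hA.1, fun s hs => hs.1⟩

/-- The filtration of the model `(F, V)` through the subformulas of `φ`. -/
def filtration : KripkeFrame where
  W := Set.range (label V φ)
  nonempty := F.nonempty.map fun x => ⟨label V φ x, x, rfl⟩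
  R a b := (∀ A, box A ∈ a.1.1 → box A ∈ b.1.1) ∧ b.1.2 ⊆ a.1.2
  RD a b := a ≠ b ∨ ∀ s ∈ isolated V φ, label V φ s ≠ a.1

/-- The class of a point in the filtration. -/
def toFiltration (x : F.W) : (filtration V φ).W := ⟨label V φ x, x, rfl⟩

/-- Irreflexive classes come from isolated points `s`, `t`. Each sees itself, so inclusion of the
recorded sets both ways yields `R s t` and `R t s`. -/
theorem isT0Frame_filtration (hF : IsT0Frame F) : IsT0Frame (filtration V φ) where
  refl a := ⟨fun _ h => h, subset_rfl⟩
  trans a b c hab hbc := ⟨fun A h => hbc.1 A (hab.1 A h), hbc.2.trans hab.2⟩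
  dacc_of_ne a b h := Or.inl h
  t0 a b ha hb hab hba := by
    have key : ∀ a : (filtration V φ).W, ¬ (filtration V φ).RD a a →
        ∃ s ∈ isolated V φ, label V φ s = a.1 := fun a ha => by
      by_contra! h
      exact ha (Or.inr h)
    obtain ⟨s, hs, hsa⟩ := key a ha
    obtain ⟨t, ht, htb⟩ := key b hb
    have hst : F.R s t := by
      have : t ∈ a.1.2 := hab.2 (htb ▸ (⟨ht, hF.refl t⟩ : t ∈ (label V φ t).2))
      rw [← hsa] at this
      exact this.2
    have hts : F.R t s := by
      have : s ∈ b.1.2 := hba.2 (hsa ▸ (⟨hs, hF.refl s⟩ : s ∈ (label V φ s).2))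
      rw [← htb] at this
      exact this.2
    have := hF.t0 s t hs.1 ht.1 hst hts
    exact Subtype.ext (by rw [← hsa, ← htb, this])

theorem truth_filtration (hF : IsT0Frame F) (A : Formula) (hA : A ∈ subformulas φ) (x : F.W) :
    Truth (filtration V φ) (fun n => {a | var n ∈ a.1.1}) (toFiltration V φ x) A ↔
      Truth F V x A := by
  induction A generalizing x with
  | var n => exact ⟨fun h => h.2, fun h => ⟨hA, h⟩⟩
  | bot => rfl
  | imp A B ihA ihB =>
    have h := subformulas_trans hA
    have hA' := ihA (h (by simp [subformulas, self_mem_subformulas])) x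
    have hB' := ihB (h (by simp [subformulas, self_mem_subformulas])) x
    simp only [Truth, hA', hB']
  | box A ih =>
    have ih := ih (subformulas_trans hA (by simp [subformulas, self_mem_subformulas]))
    constructor
    · intro h y hxy
      refine (ih y).1 (h _ ⟨fun B hB => ⟨hB.1, fun z hyz => hB.2 z (hF.trans _ _ _ hxy hyz)⟩,
        fun s hs => ⟨hs.1, hF.trans _ _ _ hxy hs.2⟩⟩)
    · rintro h ⟨_, y, rfl⟩ hxy
      exact (ih y).2 ((hxy.1 A ⟨hA, h⟩).2 y (hF.refl y))
  | dbox A ih =>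
    have hA' := subformulas_trans hA (by simp [subformulas, self_mem_subformulas] :
      A ∈ subformulas (dbox A))
    have ih := ih hA'
    constructor
    · intro h y hxy
      refine (ih y).1 (h _ ?_)
      by_cases hne : label V φ x = label V φ y
      -- If the common class were that of an isolated `s`, then `x = y = s`, against irreflexivity.
      · refine Or.inr fun s hs hsx => hs.1 ?_
        have hx : x = s := hs.2 x (congrArg Prod.fst hsx).symm
        have hy : y = s := hs.2 y (congrArg Prod.fst (hsx.trans hne)).symm
        rwa [hx, hy] at hxy
      · exact Or.inl fun h => hne (congrArg Subtype.val h)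
    · rintro h ⟨_, y, rfl⟩ hxy
      refine (ih y).2 ?_
      by_cases hne : x = y
      · subst hne
        rcases hxy with hxy | hxy
        · exact absurd rfl hxy
        by_cases hx : F.RD x x
        · exact h x hx
        -- An irreflexive non-isolated point shares its type with another point, which it sees by
        -- `R_D`.
        have hiso : x ∉ isolated V φ := fun hx => hxy x hx rfl
        simp only [isolated, Set.mem_ofPred_eq, not_and, not_forall] at hiso
        obtain ⟨z, hz, hne⟩ := hiso hx
        have : A ∈ typeOf V φ z := ⟨hA', h z (hF.dacc_of_ne _ _ (Ne.symm hne))⟩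
        rw [hz] at this
        exact this.2
      · exact h y (hF.dacc_of_ne _ _ hne)

end Filtration

/-! ### Generated canonical frame and completeness -/

section Canonical

/-- The part of the canonical frame generated by `x₀`. -/
def canonicalFrame (x₀ : World S4DT0) : KripkeFrame where
  W := {x : World S4DT0 // x₀ = x ∨ World.DAcc x₀ x}
  nonempty := ⟨⟨x₀, Or.inl rfl⟩⟩
  R x y := World.Acc x.1 y.1
  RD x y := World.DAcc x.1 y.1

variable (x₀ : World S4DT0)

theorem canonicalFrame_dacc_of_ne (x y : (canonicalFrame x₀).W) (hne : x.1 ≠ y.1) :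
    World.DAcc x.1 y.1 := by
  obtain ⟨x, hx⟩ := x
  obtain ⟨y, hy⟩ := y
  rcases hx with rfl | hx <;> rcases hy with rfl | hy
  · exact absurd rfl hne
  · exact hy
  · exact World.dacc_symm hx
  · exact World.dacc_trans (World.dacc_symm hx) hy hne

theorem isT0Frame_canonicalFrame : IsT0Frame (canonicalFrame x₀) where
  refl x := World.acc_refl x.1
  trans _ _ _ := World.acc_trans
  dacc_of_ne x y h := canonicalFrame_dacc_of_ne x₀ x y fun h' => h (Subtype.ext h')
  t0 x y hx hy hxy hyx := Subtype.ext (World.eq_of_acc_of_not_dacc_self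
    (canonicalFrame_dacc_of_ne x₀ x y) hx hy hxy hyx)

theorem dacc_closed {x y : World S4DT0} (hx : x₀ = x ∨ World.DAcc x₀ x) (hxy : World.DAcc x y) :
    x₀ = y ∨ World.DAcc x₀ y := by
  rcases hx with rfl | hx
  · exact Or.inr hxy
  · exact or_iff_not_imp_left.2 (World.dacc_trans hx hxy)

theorem truth_canonicalFrame (A : Formula) (x : (canonicalFrame x₀).W) :
    Truth (canonicalFrame x₀) (fun n => {y | var n ∈ y.1}) x A ↔ A ∈ x.1 := by
  induction A generalizing x with
  | var n => rfl
  | bot => simp [Truth]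
  | imp A B hA hB => simp [Truth, hA, hB]
  | box A ih =>
    simp only [Truth, ih, World.box_iff isNormalLogic_S4DT0]
    refine ⟨fun h y hy => ?_, fun h y hy => h y.1 hy⟩
    by_cases hne : x.1 = y
    · exact hne ▸ h x (World.acc_refl x.1)
    · exact h ⟨y, dacc_closed x₀ x.2 (World.dacc_of_acc hy hne)⟩ hy
  | dbox A ih =>
    simp only [Truth, ih, World.dbox_iff isNormalLogic_S4DT0]
    exact ⟨fun h y hy => h ⟨y, dacc_closed x₀ x.2 hy⟩ hy, fun h y hy => h y.1 hy⟩

theorem exists_finite_countermodel {A : Formula} (hA : A ∉ S4DT0) :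
    ∃ F : KripkeFrame, Finite F.W ∧ IsT0Frame F ∧ ¬ F.Valid A := by
  obtain ⟨x₀, -, hx₀⟩ := exists_world isNormalLogic_S4DT0
    (⟨subset_rfl, isNormalLogic_S4DT0.mp⟩ : IsTheory S4DT0 S4DT0) hA
  have hF := isT0Frame_canonicalFrame x₀
  refine ⟨filtration (F := canonicalFrame x₀) (fun n => {y | var n ∈ y.1}) A,
    (finite_range_label _ A).to_subtype, isT0Frame_filtration _ A hF, fun h => hx₀ ?_⟩
  exact (truth_canonicalFrame x₀ A ⟨x₀, Or.inl rfl⟩).1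
    ((truth_filtration _ A hF A (self_mem_subformulas A) _).1 (h _ (toFiltration _ A _)))

end Canonical

end DiffLogic

theorem mainTheorem2 :
    ∃ Q : Set DiffLogic.KripkeFrame,
      (∀ F ∈ Q, Finite F.W) ∧ DiffLogic.logicOf Q = DiffLogic.S4DT0 := by
  refine ⟨{F | Finite F.W ∧ DiffLogic.IsT0Frame F}, fun F hF => hF.1, Set.Subset.antisymm ?_ ?_⟩
  · intro A hA
    by_contra h
    obtain ⟨F, hfin, hF, hFA⟩ := DiffLogic.exists_finite_countermodel h
    exact hFA (hA F ⟨hfin, hF⟩)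
  · exact fun A hA F hF => hF.2.valid hA
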